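/- Let $(\Omega,\mathcal M,\mu)$ be a probability space, let $\Sigma$ be an index set and let $(d_\sigma)_{\sigma\in\Sigma}$ be a family of positive integers. For $n\ge 1$ let $S_n^2$ be the space $M_n$ of complex $n\times n$ matrices with the Hilbert–Schmidt norm $\|D\|_{S_n^2}=\big(\sum_{i,j}|D_{ij}|^2\big)^{1/2}$. Let $\{\rho^\sigma:\Omega\to O(d_\sigma)\}_{\sigma\in\Sigma}$ be a quantized Rademacher system, i.e. a family of independent random real orthogonal matrices such that $\rho^\sigma$ is distributed according to the normalized Haar measure of $O(d_\sigma)$. Let $(\widetilde\Omega,\widetilde\mu)=\prod_{k=1}^\infty(\Omega,\mu)$. For $k\ge1$ let $\rho^{\sigma,k}(\widetilde\omega)=\rho^\sigma(\widetilde\omega_k)$, and for $m\ge1$ define $$\rho^\sigma(m)=\frac1{\sqrt m}\sum_{k=1}^m\rho^{\sigma,k}:\widetilde\Omega\to M_{d_\sigma}.$$ Let $\{\widetilde\gamma^\sigma:\widetilde\Omega\to M_{d_\sigma}\}_{\sigma\in\Sigma}$ be a quantized gaussian system on $\widetilde\Omega$, i.e. $\widetilde\gamma^\sigma=d_\sigma^{-1/2}\,(\gamma^\sigma_{ij})_{1\le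 i,j\le d_\sigma}$, where the $\gamma_{ij}^\sigma$ ($\sigma\in\Sigma$, $1\le i,j\le d_\sigma$) are independent real gaussian random variables on $(\widetilde\Omega,\widetilde\mu)$ with mean $0$ and variance $1$. Let $\Sigma_0=\{\sigma_1,\dots,\sigma_n\}$ be a finite subset of $\Sigma$ and let $h:S^2_{d_{\sigma_1}}\times\cdots\times S^2_{d_{\sigma_n}}\to\mathbb R$ be a continuous function such that $$h(D^{\sigma_1},\dots,D^{\sigma_n})\,e^{-\sum_{j=1}^n\|D^{\sigma_j}\|_{S^2_{d_{\sigma_j}}}}\longrightarrow0\qquad\text{as}\qquad\sum_{j=1}^n\|D^{\sigma_j}\|_{S^2_{d_{\sigma_j}}}\to\infty .$$ Then $h(\rho^{\sigma_1}(m),\dots,\rho^{\sigma_n}(m))$ (for every $m\ge1$) and $h(\widetilde\gamma^{\sigma_1},\dots,\widetilde\gamma^{\sigma_n})$ are $\widetilde\mu$-integrable, and $$\lim_{m\to\infty}\int_{\widetilde\Omega}h(\rho^{\sigma_1}(m),\dots,\rho^{\sigma_n}(m))\,d\widetilde\mu=\int_{\widetilde\Omega}h(\widetilde\gamma^{\sigma_1},\dots,\widetilde\gamma^{\sigma_n})\,d\widetilde\mu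 .$$ -/

import Mathlib

open MeasureTheory ProbabilityTheory Filter Topology

noncomputable section

/-- The real orthogonal group `O(n)` carries its Borel σ-algebra. -/
instance orthogonalGroupMeasurableSpace (n : ℕ) :
    MeasurableSpace (Matrix.orthogonalGroup (Fin n) ℝ) :=
  borel _

instance orthogonalGroupBorelSpace (n : ℕ) :
    BorelSpace (Matrix.orthogonalGroup (Fin n) ℝ) :=
  ⟨rfl⟩

instance orthogonalGroupCompactSpace (n : ℕ) :
    CompactSpace (Matrix.orthogonalGroup (Fin n) ℝ) := by
  have hK : IsCompact (Set.univ.pi fun _ : Fin n => Set.univ.pi fun _ : Fin n =>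
      Set.Icc (-1 : ℝ) 1) :=
    isCompact_univ_pi fun _ => isCompact_univ_pi fun _ => isCompact_Icc
  have hclosed : IsClosed
      ((Matrix.orthogonalGroup (Fin n) ℝ : Set (Matrix (Fin n) (Fin n) ℝ))) := by
    have h : ((Matrix.orthogonalGroup (Fin n) ℝ : Set (Matrix (Fin n) (Fin n) ℝ))) =
        {A | A * A.transpose = 1} := by
      ext A
      exact Matrix.mem_orthogonalGroup_iff (Fin n) ℝ
    rw [h]
    exact isClosed_eq (continuous_id.matrix_mul continuous_id.matrix_transpose)
      continuous_const
  refine isCompact_iff_compactSpace.mp (hK.of_isClosed_subset hclosed ?_)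
  intro A hA i _ j _
  have h := entry_norm_bound_of_unitary (𝕜 := ℝ) hA i j
  rw [Real.norm_eq_abs] at h
  exact abs_le.mp h

/-- The normalized Haar measure on the orthogonal group `O(n)`. -/
def orthogonalHaar (n : ℕ) : Measure (Matrix.orthogonalGroup (Fin n) ℝ) :=
  Measure.haarMeasure ⊤

/-- The norm of the Schatten class `S_n^2` (Hilbert–Schmidt or Frobenius norm) on complex
`n × n` matrices. -/
def schattenTwoNorm {n : ℕ} (D : Matrix (Fin n) (Fin n) ℂ) : ℝ :=
  letI : NormedAddCommGroup (Matrix (Fin n) (Fin n) ℂ) := Matrix.frobeniusNormedAddCommGroup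
  ‖D‖

/-- A quantized Rademacher system with parameters `(S, d)` on `(Ω, μ)`: independent random
orthogonal matrices `ρ σ`, uniformly distributed on `O(d σ)`. -/
structure IsQuantizedRademacher {S Ω : Type*} [MeasurableSpace Ω] (μ : Measure Ω) (d : S → ℕ)
    (ρ : (σ : S) → Ω → Matrix.orthogonalGroup (Fin (d σ)) ℝ) : Prop where
  measurable : ∀ σ, Measurable (ρ σ)
  indep : iIndepFun ρ μ
  law : ∀ σ, μ.map (ρ σ) = orthogonalHaar (d σ)

/-- A quantized gaussian system with parameters `(S, d)` on `(Ω, μ)`: random matrices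
`γ σ = (d σ)^(-1/2) (g σ i j)`, where the `g σ i j` are independent (over all `σ`, `i`, `j`)
real gaussian variables of mean zero and variance one. -/
def IsQuantizedGaussian {S Ω : Type*} [MeasurableSpace Ω] (μ : Measure Ω) (d : S → ℕ)
    (γ : (σ : S) → Ω → Matrix (Fin (d σ)) (Fin (d σ)) ℂ) : Prop :=
  ∃ g : (Σ σ : S, Fin (d σ) × Fin (d σ)) → Ω → ℝ,
    (∀ p, Measurable (g p)) ∧ iIndepFun g μ ∧ (∀ p, μ.map (g p) = gaussianReal 0 1) ∧
    ∀ (σ : S) (ω : Ω) (i j : Fin (d σ)),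
      γ σ ω i j = ((1 / Real.sqrt (d σ) * g ⟨σ, i, j⟩ ω : ℝ) : ℂ)

/-- The copy `ρ^{σ,k}` of `ρ σ` on the infinite product of copies of `Ω`, depending only on the
`k`-th coordinate, seen as a complex matrix. -/
def rademacherCopy {S Ω : Type*} {d : S → ℕ}
    (ρ : (σ : S) → Ω → Matrix.orthogonalGroup (Fin (d σ)) ℝ) (σ : S) (k : ℕ) (ω : ℕ → Ω) :
    Matrix (Fin (d σ)) (Fin (d σ)) ℂ :=
  (ρ σ (ω k)).1.map fun x : ℝ => (x : ℂ)

/-- The normalized sum `ρ^σ(m) = m^(-1/2) ∑ ρ^{σ,k}` of the first `m` copies. -/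
def rademacherSum {S Ω : Type*} {d : S → ℕ}
    (ρ : (σ : S) → Ω → Matrix.orthogonalGroup (Fin (d σ)) ℝ) (m : ℕ) (σ : S) (ω : ℕ → Ω) :
    Matrix (Fin (d σ)) (Fin (d σ)) ℂ :=
  ((1 / Real.sqrt m : ℝ) : ℂ) • ∑ k ∈ Finset.range m, rademacherCopy ρ σ k ω

end

/-! Collect the entries of all the matrices `ρ σ`, with `σ` in the finite set, into one random
vector. It is centred and bounded, and its covariance is diagonal with entries `1 / d σ`: inside one
matrix by the invariance of Haar measure under reflections and row swaps, between different matrices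
by independence. The gaussian system has the same covariance, so the central limit theorem gives
convergence in law of the normalized sums (`tendstoInDistribution_euclidean_inv_sqrt_mul_sum`).

As `h` is unbounded, convergence in law is not enough. Bounded centred entries are sub-gaussian,
with a constant that normalized sums preserve, so the exponential of the sum of the absolute values
of the entries has expectation bounded uniformly in `m` (`integrable_and_integral_exp_sum_abs_le`).
This exponential dominates that of the Hilbert–Schmidt norms, against which `h` is negligible;
truncating `h` then gives convergence of the integrals (`tendsto_integral_of_tendsto_of_weight`). -/

noncomputable section

/-! ### First and second moments of Haar measure on the orthogonal group. -/

section OrthogonalGroup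

open Matrix

instance isHaarMeasure_orthogonalHaar (n : ℕ) : (orthogonalHaar n).IsHaarMeasure := by
  unfold orthogonalHaar; infer_instance

instance isProbabilityMeasure_orthogonalHaar (n : ℕ) : IsProbabilityMeasure (orthogonalHaar n) :=
  ⟨Measure.haarMeasure_self⟩

lemma orthogonalGroup_abs_entry_le_one {n : ℕ} (A : orthogonalGroup (Fin n) ℝ) (i j : Fin n) :
    |A.1 i j| ≤ 1 := by
  simpa [Real.norm_eq_abs] using entry_norm_bound_of_unitary (𝕜 := ℝ) A.2 i j

lemma continuous_orthogonalGroup_entry {n : ℕ} (i j : Fin n) :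
    Continuous fun A : orthogonalGroup (Fin n) ℝ => A.1 i j :=
  continuous_subtype_val.matrix_elem i j

lemma integrable_orthogonalHaar_entry_mul {n : ℕ} (i j k l : Fin n) :
    Integrable (fun A => A.1 i j * A.1 k l) (orthogonalHaar n) :=
  ((continuous_orthogonalGroup_entry i j).mul
    (continuous_orthogonalGroup_entry k l)).integrable_of_hasCompactSupport
      (HasCompactSupport.of_compactSpace _)

/-- The reflection of `ℝⁿ` in the `i`-th coordinate. -/
def coordReflection {n : ℕ} (i : Fin n) : orthogonalGroup (Fin n) ℝ :=
  ⟨diagonal (Function.update 1 i (-1)), by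
    rw [mem_orthogonalGroup_iff, diagonal_transpose,
      diagonal_mul_diagonal, ← diagonal_one]
    congr 1
    ext k
    by_cases h : k = i
    · subst h; simp
    · simp [h]⟩

lemma coordReflection_mul_apply {n : ℕ} (i k l : Fin n) (A : orthogonalGroup (Fin n) ℝ) :
    (coordReflection i * A).1 k l = (if k = i then -1 else 1) * A.1 k l := by
  change (diagonal (Function.update (1 : Fin n → ℝ) i (-1)) * A.1) k l = _
  rw [diagonal_mul, Function.update_apply]
  simp

/-- The permutation matrix exchanging two coordinates. -/
def coordSwap {n : ℕ} (i k : Fin n) : orthogonalGroup (Fin n) ℝ :=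
  ⟨(Equiv.swap i k).toPEquiv.toMatrix, by
    rw [mem_orthogonalGroup_iff, ← PEquiv.toMatrix_symm, ← PEquiv.toMatrix_trans, ← Equiv.toPEquiv_symm,
      ← Equiv.toPEquiv_trans]
    simp⟩

lemma coordSwap_mul_apply {n : ℕ} (i k l m : Fin n) (A : orthogonalGroup (Fin n) ℝ) :
    (coordSwap i k * A).1 l m = A.1 (Equiv.swap i k l) m := by
  change ((Equiv.swap i k).toPEquiv.toMatrix * A.1 : Matrix (Fin n) (Fin n) ℝ) l m = _
  rw [PEquiv.toMatrix_toPEquiv_mul]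
  rfl

lemma integral_orthogonalHaar_entry {n : ℕ} (i j : Fin n) :
    ∫ A, A.1 i j ∂(orthogonalHaar n) = 0 := by
  have h := integral_mul_left_eq_self (μ := orthogonalHaar n) (fun A => A.1 i j)
    (coordReflection i)
  simp only [coordReflection_mul_apply, if_true, neg_mul, one_mul, integral_neg] at h
  linarith

/-- Reflecting the `i`-th coordinate changes the sign of row `i` only, hence of exactly one factor,
so the integral equals its own negative. -/
lemma integral_orthogonalHaar_entry_mul_of_ne {n : ℕ} {i k : Fin n} (hik : i ≠ k) (j l : Fin n) :
    ∫ A, A.1 i j * A.1 k l ∂(orthogonalHaar n) = 0 := by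
  have h := integral_mul_left_eq_self (μ := orthogonalHaar n) (fun A => A.1 i j * A.1 k l)
    (coordReflection i)
  simp only [coordReflection_mul_apply, if_true, if_neg hik.symm, neg_mul, one_mul,
    integral_neg] at h
  linarith

/-- Invariance under row swaps makes the integral independent of the row, and the sum over the `n`
rows is known because the columns are orthonormal. -/
lemma integral_orthogonalHaar_entry_mul_same_row {n : ℕ} (i j l : Fin n) :
    ∫ A, A.1 i j * A.1 i l ∂(orthogonalHaar n) = if j = l then (n : ℝ)⁻¹ else 0 := by
  have hconst : ∀ k, ∫ A, A.1 k j * A.1 k l ∂(orthogonalHaar n) =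
      ∫ A, A.1 i j * A.1 i l ∂(orthogonalHaar n) := fun k => by
    simpa [coordSwap_mul_apply] using
      (integral_mul_left_eq_self (μ := orthogonalHaar n) (fun A => A.1 k j * A.1 k l)
        (coordSwap i k)).symm
  have hcol : ∀ A : orthogonalGroup (Fin n) ℝ,
      ∑ k, A.1 k j * A.1 k l = if j = l then 1 else 0 := fun A => by
    have h := congrFun (congrFun ((mem_orthogonalGroup_iff' (Fin n) ℝ).1 A.2) j) l
    simpa [mul_apply, star_eq_conjTranspose, one_apply] using h
  have hsum : ∑ k, ∫ A, A.1 k j * A.1 k l ∂(orthogonalHaar n) = if j = l then 1 else 0 := by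
    rw [← integral_finsetSum _ fun k _ => integrable_orthogonalHaar_entry_mul k j k l]
    simp [hcol]
  simp only [hconst, Finset.sum_const, Finset.card_univ, Fintype.card_fin, nsmul_eq_mul] at hsum
  have hn : (n : ℝ) ≠ 0 := Nat.cast_ne_zero.2 (Fin.pos i).ne'
  split_ifs at hsum ⊢
  · exact eq_inv_of_mul_eq_one_right hsum
  · exact (mul_eq_zero.1 hsum).resolve_left hn

lemma integral_orthogonalHaar_entry_mul {n : ℕ} (p q : Fin n × Fin n) :
    ∫ A, A.1 p.1 p.2 * A.1 q.1 q.2 ∂(orthogonalHaar n) = if p = q then (n : ℝ)⁻¹ else 0 := by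
  obtain ⟨i, j⟩ := p
  obtain ⟨k, l⟩ := q
  by_cases hik : i = k
  · subst hik
    simp [integral_orthogonalHaar_entry_mul_same_row]
  · simp [hik, integral_orthogonalHaar_entry_mul_of_ne hik]

end OrthogonalGroup

/-! ### Weak convergence tested on unbounded functions. -/

section WeakConvergence

/-- Clipping to `[-K, K]` moves `x` only when `|x| > K`, and then by at most `|x|`. This controls
the truncation error. -/
lemma abs_sub_clip_le {x K b : ℝ} (hK : 0 ≤ K) (hb : 0 ≤ b) (h : |x| ≤ K ∨ |x| ≤ b) :
    |x - max (-K) (min x K)| ≤ b := by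
  rcases h with h | h
  · rw [abs_le] at h
    rw [min_eq_left h.2, max_eq_right h.1]
    simpa using hb
  · refine le_trans ?_ h
    rcases le_total x K with h1 | h1
    · rw [min_eq_left h1]
      rcases le_total (-K) x with h2 | h2
      · rw [max_eq_right h2]; simp
      · rw [max_eq_left h2, abs_of_nonpos (by linarith), abs_of_nonpos (by linarith)]
        linarith
    · rw [min_eq_right h1, max_eq_right (by linarith), abs_of_nonneg (by linarith),
        abs_of_nonneg (by linarith)]
      linarith

variable {E : Type*} [TopologicalSpace E] [MeasurableSpace E] [OpensMeasurableSpace E]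

/-- A function which is negligible with respect to an integrable weight, up to a bounded part, is
integrable. -/
lemma integrable_of_le_or_le_mul {μ : Measure E} [IsFiniteMeasure μ] {f w : E → ℝ}
    (hf : Continuous f) (hw : ∀ x, 0 ≤ w x) (hint : Integrable w μ)
    (h : ∀ ε > 0, ∃ K, ∀ x, |f x| ≤ K ∨ |f x| ≤ ε * w x) : Integrable f μ := by
  obtain ⟨K, hK⟩ := h 1 one_pos
  refine ((integrable_const |K|).add hint).mono' hf.measurable.aestronglyMeasurable
    (Eventually.of_forall fun x => ?_)
  have := hw x
  have h1 := le_abs_self K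
  have h2 := abs_nonneg K
  rw [Real.norm_eq_abs, Pi.add_apply]
  rcases hK x with h | h <;> linarith

/-- Weak convergence of probability measures gives convergence of the integrals of a continuous
function which is negligible with respect to a weight whose integrals are bounded. -/
theorem tendsto_integral_of_tendsto_of_weight {ν : ℕ → ProbabilityMeasure E}
    {ν₀ : ProbabilityMeasure E} (hν : Tendsto ν atTop (𝓝 ν₀)) {f w : E → ℝ} (hf : Continuous f)
    (hw : ∀ x, 0 ≤ w x) {M : ℝ} (hint : ∀ n, Integrable w (ν n : Measure E))
    (hM : ∀ n, ∫ x, w x ∂(ν n : Measure E) ≤ M) (hint₀ : Integrable w (ν₀ : Measure E))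
    (h : ∀ ε > 0, ∃ K, ∀ x, |f x| ≤ K ∨ |f x| ≤ ε * w x) :
    Tendsto (fun n => ∫ x, f x ∂(ν n : Measure E)) atTop (𝓝 (∫ x, f x ∂(ν₀ : Measure E))) := by
  set M' := max M (∫ x, w x ∂(ν₀ : Measure E)) with hM'
  have hM'0 : 0 ≤ M' := le_max_of_le_right (integral_nonneg hw)
  rw [Metric.tendsto_atTop]
  intro ε hε
  -- `M'` bounds the integral of the weight under every measure involved, so each truncation costs
  -- at most `ε / 3`; the `+ 1` keeps the denominator positive when `M' = 0`.
  obtain ⟨K, hK⟩ := h (ε / (3 * (M' + 1))) (by positivity)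
  have hK' : ∀ x, |f x| ≤ |K| ∨ |f x| ≤ ε / (3 * (M' + 1)) * w x := fun x =>
    (hK x).imp_left fun h => h.trans (le_abs_self K)
  let g : BoundedContinuousFunction E ℝ :=
    BoundedContinuousFunction.ofNormedAddCommGroup (fun x => max (-|K|) (min (f x) |K|))
      (by fun_prop) |K| fun x => by
        have := abs_nonneg K
        rw [Real.norm_eq_abs, abs_le]
        exact ⟨le_max_left _ _, max_le (by linarith) (min_le_right _ _)⟩
  have hclose : ∀ (κ : ProbabilityMeasure E), Integrable w (κ : Measure E) →
      ∫ x, w x ∂(κ : Measure E) ≤ M' →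
      |∫ x, f x ∂(κ : Measure E) - ∫ x, g x ∂(κ : Measure E)| ≤ ε / 3 := by
    intro κ hκ hκM
    rw [← integral_sub (integrable_of_le_or_le_mul hf hw hκ h) (g.integrable _)]
    calc |∫ x, (f x - g x) ∂(κ : Measure E)|
        ≤ ∫ x, ε / (3 * (M' + 1)) * w x ∂(κ : Measure E) :=
          norm_integral_le_of_norm_le (f := fun x => f x - g x) (hκ.const_mul _) (Eventually.of_forall fun x =>
            abs_sub_clip_le (abs_nonneg K) (mul_nonneg (by positivity) (hw x)) (hK' x))
      _ = ε / (3 * (M' + 1)) * ∫ x, w x ∂(κ : Measure E) := integral_const_mul _ _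
      _ ≤ ε / (3 * (M' + 1)) * (M' + 1) := by gcongr; linarith
      _ = ε / 3 := by field_simp
  have hg := ProbabilityMeasure.tendsto_iff_forall_integral_tendsto.1 hν g
  obtain ⟨N, hN⟩ := Metric.tendsto_atTop.1 hg (ε / 3) (by positivity)
  refine ⟨N, fun n hn => ?_⟩
  have h1 := hclose (ν n) (hint n) ((hM n).trans (le_max_left _ _))
  have h2 := hclose ν₀ hint₀ (le_max_right _ _)
  have h3 := hN n hn
  rw [Real.dist_eq] at h3 ⊢
  rw [abs_le] at h1 h2
  rw [abs_lt] at h3 ⊢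
  constructor <;> linarith

end WeakConvergence

/-! ### The central limit theorem in Euclidean space. -/

section CentralLimit

variable {Ω Ω' ι : Type*} [MeasurableSpace Ω] [MeasurableSpace Ω']

lemma measurable_toLp_inv_sqrt_mul_sum {Y : ι → Ω → ℝ} (hY : ∀ p, Measurable (Y p)) (m : ℕ) :
    Measurable fun ω : ℕ → Ω => (WithLp.toLp 2
      fun p => (√m)⁻¹ * ∑ k ∈ Finset.range m, Y p (ω k) : EuclideanSpace ℝ ι) :=
  (WithLp.measurable_toLp 2 (ι → ℝ)).comp <| measurable_pi_lambda _ fun p =>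
    (Finset.measurable_sum _ fun k _ => (hY p).comp (measurable_pi_apply k)).const_mul _

variable [Fintype ι]

/-- The Cramér–Wold device: it reduces the vector limit theorem to the scalar one. -/
lemma charFun_map_eq_charFun_map_inner {P : Measure Ω} {X : Ω → EuclideanSpace ℝ ι}
    (hX : AEMeasurable X P) (t : EuclideanSpace ℝ ι) :
    charFun (P.map X) t = charFun (P.map fun ω => ∑ p, t p * X ω p) 1 := by
  rw [charFun_apply, charFun_apply, integral_map hX (by fun_prop),
    integral_map (by fun_prop) (by fun_prop)]
  simp [PiLp.inner_apply]

lemma charFun_map_sum_mul_of_iIndepFun {P : Measure Ω} {g : ι → Ω → ℝ}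
    (hg : ∀ p, Measurable (g p)) (hind : iIndepFun g P)
    (hlaw : ∀ p, P.map (g p) = gaussianReal 0 1) (c : ι → ℝ) :
    charFun (P.map fun ω => ∑ p, c p * g p ω) 1 =
      charFun (gaussianReal 0 (∑ p, c p ^ 2).toNNReal) 1 := by
  have hind' : iIndepFun (fun p ω => c p * g p ω) P :=
    hind.comp (fun p x => c p * x) fun p => measurable_const_mul (c p)
  rw [hind'.charFun_map_fun_sum_eq_prod fun p => ((hg p).const_mul _).aemeasurable,
    Finset.prod_apply, charFun_gaussianReal]
  simp_rw [charFun_map_mul_comp (hg _).aemeasurable, hlaw, charFun_gaussianReal]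
  rw [← Complex.exp_sum, Real.coe_toNNReal _ (by positivity)]
  congr 1
  push_cast
  simp [Finset.sum_div, Finset.sum_neg_distrib]

/-- **Multivariate central limit theorem** for a centred random vector with uncorrelated
coordinates of variance `a p ^ 2`. -/
theorem tendstoInDistribution_euclidean_inv_sqrt_mul_sum {μ : Measure Ω} [IsProbabilityMeasure μ]
    {μ' : Measure Ω'} [IsProbabilityMeasure μ'] [DecidableEq ι] {Y : ι → Ω → ℝ} {g : ι → Ω' → ℝ}
    {a : ι → ℝ}
    (hY : ∀ p, Measurable (Y p)) (hY2 : ∀ p, MemLp (Y p) 2 μ) (hmean : ∀ p, ∫ ω, Y p ω ∂μ = 0)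
    (hcov : ∀ p q, ∫ ω, Y p ω * Y q ω ∂μ = if p = q then a p ^ 2 else 0)
    (hg : ∀ p, Measurable (g p)) (hind : iIndepFun g μ')
    (hlaw : ∀ p, μ'.map (g p) = gaussianReal 0 1) :
    TendstoInDistribution
      (fun (m : ℕ) (ω : ℕ → Ω) => WithLp.toLp 2
        fun p => (√m)⁻¹ * ∑ k ∈ Finset.range m, Y p (ω k)) atTop
      (fun ω => (WithLp.toLp 2 fun p => a p * g p ω : EuclideanSpace ℝ ι))
      (fun _ => Measure.infinitePi fun _ : ℕ => μ) μ' where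
  forall_aemeasurable m :=
    (measurable_toLp_inv_sqrt_mul_sum hY m).aemeasurable
  tendsto := by
    refine ProbabilityMeasure.tendsto_iff_tendsto_charFun.2 fun t => ?_
    -- The projection of the vector on `t`; as the coordinates are uncorrelated, its variance is
    -- that of the projected gaussian limit.
    let w : Ω → ℝ := fun ω => ∑ p, t p * Y p ω
    have hw : Measurable w := by fun_prop
    have hw2 : MemLp w 2 μ := memLp_finsetSum _ fun p _ => (hY2 p).const_mul (t p)
    have hw0 : ∫ ω, w ω ∂μ = 0 := by
      rw [integral_finsetSum _ fun p _ => ((hY2 p).integrable one_le_two).const_mul (t p)]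
      simp [integral_const_mul, hmean]
    have hwvar : Var[w; μ] = ∑ p, (t p * a p) ^ 2 := by
      have hint : ∀ p q, Integrable (fun ω => t p * Y p ω * (t q * Y q ω)) μ := fun p q =>
        ((hY2 p).const_mul (t p)).integrable_mul ((hY2 q).const_mul (t q))
      rw [variance_of_integral_eq_zero hw.aemeasurable hw0]
      simp only [w, sq, Finset.sum_mul_sum]
      rw [integral_finsetSum _ fun p _ => integrable_finsetSum _ fun q _ => hint p q]
      refine Finset.sum_congr rfl fun p _ => ?_
      rw [integral_finsetSum _ fun q _ => hint p q]
      have hterm : ∀ q, ∫ ω, t p * Y p ω * (t q * Y q ω) ∂μ =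
          if p = q then t p * t q * a p ^ 2 else 0 := fun q => by
        have hcomm : (fun ω => t p * Y p ω * (t q * Y q ω)) =
            fun ω => t p * t q * (Y p ω * Y q ω) := by
          ext ω
          ring
        rw [hcomm, integral_const_mul, hcov, mul_ite, mul_zero]
      simp only [hterm, Finset.sum_ite_eq, Finset.mem_univ, if_true]
      ring
    have hmp : ∀ k : ℕ, MeasurePreserving (fun ω : ℕ → Ω => ω k)
        (Measure.infinitePi fun _ : ℕ => μ) μ := fun k =>
      measurePreserving_eval_infinitePi (fun _ : ℕ => μ) k
    have hident : ∀ k : ℕ, IdentDistrib (fun ω : ℕ → Ω => w (ω k)) w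
        (Measure.infinitePi fun _ : ℕ => μ) μ := fun k =>
      ⟨(hw.comp (hmp k).measurable).aemeasurable, hw.aemeasurable, by
        conv_rhs => rw [← (hmp k).map_eq, Measure.map_map hw (hmp k).measurable]
        rfl⟩
    have hclt := tendstoInDistribution_inv_sqrt_mul_sum_sub
      (P := Measure.infinitePi fun _ : ℕ => μ) (X := fun k ω => w (ω k)) (Y := id)
      (P' := gaussianReal 0 (∑ p, (t p * a p) ^ 2).toNNReal)
      (by rw [(hident 0).variance_eq, hwvar]; exact HasLaw.id)
      ((hident 0).memLp_iff.2 hw2)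
      (iIndepFun_infinitePi (X := fun _ => w) fun _ => hw)
      (fun k => (hident k).trans (hident 0).symm)
    have h := ProbabilityMeasure.tendsto_iff_tendsto_charFun.1 hclt.tendsto 1
    simp only [ProbabilityMeasure.coe_mk, Measure.map_id, (hident 0).integral_eq, hw0, mul_zero,
      sub_zero] at h
    simp only [ProbabilityMeasure.coe_mk]
    rw [charFun_map_eq_charFun_map_inner (by fun_prop)]
    simp only [charFun_map_eq_charFun_map_inner
      (measurable_toLp_inv_sqrt_mul_sum hY _).aemeasurable, ← mul_assoc]
    rw [charFun_map_sum_mul_of_iIndepFun hg hind hlaw]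
    convert! h using 4 with m
    ext ω
    simp only [w, Finset.mul_sum]
    rw [Finset.sum_comm]
    exact Finset.sum_congr rfl fun k _ => Finset.sum_congr rfl fun p _ => by ring

end CentralLimit

/-! ### Exponential moments, uniform in the number of summands. -/

section ExponentialMoments

variable {Ω ι : Type*} [MeasurableSpace Ω]

lemma ProbabilityTheory.HasSubgaussianMGF.mono_const {μ : Measure Ω} {X : Ω → ℝ}
    {c c' : NNReal} (h : HasSubgaussianMGF X c μ) (hc : c ≤ c') : HasSubgaussianMGF X c' μ where
  integrable_exp_mul := h.integrable_exp_mul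
  mgf_le t := (h.mgf_le t).trans <| by gcongr

/-- Hoeffding's lemma on `[-1, 1]` gives the constant 1. Independence adds the constants to `m`, and
the scaling multiplies them by `m⁻¹`; the result is 1, or 0 when `m = 0`. -/
lemma hasSubgaussianMGF_inv_sqrt_mul_sum {μ : Measure Ω} [IsProbabilityMeasure μ] {X : Ω → ℝ}
    (hX : Measurable X) (hX1 : ∀ ω, |X ω| ≤ 1) (hmean : ∫ ω, X ω ∂μ = 0) (m : ℕ) :
    HasSubgaussianMGF (fun ω : ℕ → Ω => (√m)⁻¹ * ∑ k ∈ Finset.range m, X (ω k)) 1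
      (Measure.infinitePi fun _ : ℕ => μ) := by
  have h1 : HasSubgaussianMGF X 1 μ :=
    (hasSubgaussianMGF_of_mem_Icc_of_integral_eq_zero (a := -1) (b := 1) hX.aemeasurable
      (Eventually.of_forall fun ω => abs_le.1 (hX1 ω)) hmean).mono_const (by
        rw [← NNReal.coe_le_coe]; norm_num)
  have hmp : ∀ k : ℕ, MeasurePreserving (fun ω : ℕ → Ω => ω k)
      (Measure.infinitePi fun _ : ℕ => μ) μ := fun k =>
    measurePreserving_eval_infinitePi (fun _ : ℕ => μ) k
  have hk : ∀ k : ℕ, HasSubgaussianMGF (fun ω : ℕ → Ω => X (ω k)) 1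
      (Measure.infinitePi fun _ : ℕ => μ) := fun k =>
    HasSubgaussianMGF.of_map (Y := fun ω : ℕ → Ω => ω k) (hmp k).measurable.aemeasurable
      (by rwa [(hmp k).map_eq])
  have hsum := HasSubgaussianMGF.sum_of_iIndepFun (c := fun _ => 1) (s := Finset.range m)
    (iIndepFun_infinitePi (P := fun _ : ℕ => μ) (X := fun _ => X) fun _ => hX) fun k _ => hk k
  refine (hsum.const_mul (√m)⁻¹).mono_const ?_
  rw [← NNReal.coe_le_coe]
  change (√m)⁻¹ ^ 2 * ((∑ _k ∈ Finset.range m, 1 : NNReal) : ℝ) ≤ 1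
  rw [inv_pow, Real.sq_sqrt (Nat.cast_nonneg m)]
  simpa using inv_mul_le_one (a := (m : ℝ))

lemma hasSubgaussianMGF_mul_of_gaussianReal {μ : Measure Ω} {g : Ω → ℝ} (hg : Measurable g)
    (hlaw : μ.map g = gaussianReal 0 1) {a : ℝ} (ha : a ^ 2 ≤ 1) :
    HasSubgaussianMGF (fun ω => a * g ω) 1 μ := by
  have h : HasSubgaussianMGF g 1 μ := by
    refine ⟨fun t => ?_, fun t => ?_⟩
    · have h := integrable_exp_mul_gaussianReal (μ := 0) (v := 1) t
      rw [← hlaw] at h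
      exact h.comp_measurable hg
    · rw [mgf_gaussianReal hlaw]; simp
  refine (h.const_mul a).mono_const ?_
  rw [← NNReal.coe_le_coe]
  change a ^ 2 * ((1 : NNReal) : ℝ) ≤ 1
  simpa only [NNReal.coe_one, mul_one] using ha

variable [Fintype ι]

/-- The sum is at most `card ι` times its largest term. The bound involves one coordinate at a time,
so moment generating functions at `± card ι` suffice and no independence between coordinates is
needed. The summand 1 covers empty `ι`. -/
lemma exp_sum_abs_le (x : ι → ℝ) :
    Real.exp (∑ p, |x p|) ≤ 1 + ∑ p, (Real.exp (Fintype.card ι * x p) +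
      Real.exp (-Fintype.card ι * x p)) := by
  cases isEmpty_or_nonempty ι
  · simp
  obtain ⟨q, hq⟩ := Finite.exists_max fun p => |x p|
  have h1 : ∑ p, |x p| ≤ Fintype.card ι * |x q| := by
    rw [← nsmul_eq_mul]
    exact Finset.sum_le_card_nsmul Finset.univ _ _ fun p _ => hq p
  have h2 : Real.exp (Fintype.card ι * |x q|) ≤
      Real.exp (Fintype.card ι * x q) + Real.exp (-Fintype.card ι * x q) := by
    rcases abs_choice (x q) with h | h <;> rw [h]
    · linarith [Real.exp_pos (-Fintype.card ι * x q)]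
    · rw [mul_neg, ← neg_mul]
      linarith [Real.exp_pos (Fintype.card ι * x q)]
  have h3 := Finset.single_le_sum
    (f := fun p => Real.exp (Fintype.card ι * x p) + Real.exp (-Fintype.card ι * x p))
    (fun p _ => by positivity) (Finset.mem_univ q)
  linarith [Real.exp_le_exp.2 h1]

lemma integrable_and_integral_exp_sum_abs_le {μ : Measure Ω} [IsProbabilityMeasure μ]
    {X : ι → Ω → ℝ} (hX : ∀ p, HasSubgaussianMGF (X p) 1 μ) :
    Integrable (fun ω => Real.exp (∑ p, |X p ω|)) μ ∧
      ∫ ω, Real.exp (∑ p, |X p ω|) ∂μ ≤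
        1 + Fintype.card ι * (2 * Real.exp ((Fintype.card ι : ℝ) ^ 2 / 2)) := by
  set n : ℝ := (Fintype.card ι : ℝ) with hn
  have hint : ∀ p, Integrable (fun ω => Real.exp (n * X p ω) + Real.exp (-n * X p ω)) μ :=
    fun p => ((hX p).integrable_exp_mul n).add ((hX p).integrable_exp_mul (-n))
  have hint' : Integrable
      (fun ω => 1 + ∑ p, (Real.exp (n * X p ω) + Real.exp (-n * X p ω))) μ :=
    (integrable_const _).add (integrable_finsetSum _ fun p _ => hint p)
  have hmeas : AEStronglyMeasurable (fun ω => Real.exp (∑ p, |X p ω|)) μ := by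
    have := fun p => (hX p).aemeasurable
    exact AEMeasurable.aestronglyMeasurable (by fun_prop)
  have hexp : Integrable (fun ω => Real.exp (∑ p, |X p ω|)) μ :=
    hint'.mono' hmeas (Eventually.of_forall fun ω => by
      rw [Real.norm_eq_abs, Real.abs_exp]
      exact exp_sum_abs_le fun p => X p ω)
  refine ⟨hexp, (integral_mono hexp hint' fun ω => exp_sum_abs_le fun p => X p ω).trans ?_⟩
  rw [integral_add (integrable_const _) (integrable_finsetSum _ fun p _ => hint p),
    integral_finsetSum _ fun p _ => hint p]
  have hle : ∀ p, ∫ ω, (Real.exp (n * X p ω) + Real.exp (-n * X p ω)) ∂μ ≤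
      2 * Real.exp (n ^ 2 / 2) := fun p => by
    rw [integral_add ((hX p).integrable_exp_mul n) ((hX p).integrable_exp_mul (-n))]
    have h1 := (hX p).mgf_le n
    have h2 := (hX p).mgf_le (-n)
    simp only [mgf, NNReal.coe_one, one_mul, neg_sq] at h1 h2
    linarith
  have := Finset.sum_le_card_nsmul Finset.univ _ _ fun p _ => hle p
  rw [nsmul_eq_mul] at this
  simpa using this

end ExponentialMoments

/-! ### The Hilbert–Schmidt norm and the growth condition. -/

section SchattenTwo

lemma schattenTwoNorm_eq_sqrt {n : ℕ} (D : Matrix (Fin n) (Fin n) ℂ) :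
    schattenTwoNorm D = √(∑ p : Fin n × Fin n, ‖D p.1 p.2‖ ^ 2) := by
  rw [schattenTwoNorm, Matrix.frobenius_norm_def, Real.sqrt_eq_rpow, Fintype.sum_prod_type]
  simp

lemma schattenTwoNorm_nonneg {n : ℕ} (D : Matrix (Fin n) (Fin n) ℂ) : 0 ≤ schattenTwoNorm D := by
  rw [schattenTwoNorm_eq_sqrt]; positivity

lemma norm_entry_le_schattenTwoNorm {n : ℕ} (D : Matrix (Fin n) (Fin n) ℂ) (i j : Fin n) :
    ‖D i j‖ ≤ schattenTwoNorm D := by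
  rw [schattenTwoNorm_eq_sqrt]
  exact Real.le_sqrt_of_sq_le <| Finset.single_le_sum
    (f := fun p : Fin n × Fin n => ‖D p.1 p.2‖ ^ 2) (fun _ _ => by positivity)
    (Finset.mem_univ (i, j))

lemma schattenTwoNorm_le_sum {n : ℕ} (D : Matrix (Fin n) (Fin n) ℂ) :
    schattenTwoNorm D ≤ ∑ p : Fin n × Fin n, ‖D p.1 p.2‖ := by
  rw [schattenTwoNorm_eq_sqrt]
  exact Real.sqrt_le_iff.2
    ⟨by positivity, Finset.sum_sq_le_sq_sum_of_nonneg fun _ _ => norm_nonneg _⟩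

variable {T : Type*} {d : T → ℕ}

/-- The real matrices whose entries are the coordinates of a vector, seen as complex matrices. -/
def matricesOfVector (x : EuclideanSpace ℝ (Σ σ : T, Fin (d σ) × Fin (d σ))) (σ : T) :
    Matrix (Fin (d σ)) (Fin (d σ)) ℂ :=
  Matrix.of fun i j => (x ⟨σ, i, j⟩ : ℂ)

lemma continuous_matricesOfVector : Continuous (matricesOfVector (d := d)) :=
  continuous_pi fun σ => continuous_matrix fun i j => by
    change Continuous fun x : EuclideanSpace ℝ (Σ σ : T, Fin (d σ) × Fin (d σ)) =>
      (x ⟨σ, i, j⟩ : ℂ)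
    fun_prop

variable [Fintype T]

/-- A continuous function on tuples of matrices which is negligible with respect to the
exponential of the sum of the norms is, up to a bounded part, at most a small multiple of it. -/
lemma abs_le_or_abs_le_mul_exp_of_tendsto
    {h : ((σ : T) → Matrix (Fin (d σ)) (Fin (d σ)) ℂ) → ℝ} (hcont : Continuous h)
    (hgrowth : Tendsto (fun D => h D * Real.exp (-∑ σ, schattenTwoNorm (D σ)))
      (comap (fun D => ∑ σ, schattenTwoNorm (D σ)) atTop) (𝓝 0)) {ε : ℝ} (hε : 0 < ε) :
    ∃ K, ∀ D, |h D| ≤ K ∨ |h D| ≤ ε * Real.exp (∑ σ, schattenTwoNorm (D σ)) := by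
  have hev := hgrowth.eventually (Metric.closedBall_mem_nhds 0 hε)
  rw [eventually_comap, eventually_atTop] at hev
  obtain ⟨R, hR⟩ := hev
  -- When the norms sum to at most `R`, all entries lie in the disc of radius `R`, and `h` is
  -- bounded on this compact polydisc.
  have hcompact : IsCompact (Set.univ.pi fun σ : T => Set.univ.pi fun _ : Fin (d σ) =>
      Set.univ.pi fun _ : Fin (d σ) => Metric.closedBall (0 : ℂ) R) :=
    isCompact_univ_pi fun _ => isCompact_univ_pi fun _ => isCompact_univ_pi fun _ =>
      isCompact_closedBall _ _
  obtain ⟨K, hK⟩ := hcompact.exists_bound_of_continuousOn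
    (f := (h : ((σ : T) → Fin (d σ) → Fin (d σ) → ℂ) → ℝ)) hcont.continuousOn
  refine ⟨K, fun D => ?_⟩
  rcases le_total (∑ σ, schattenTwoNorm (D σ)) R with hD | hD
  · refine .inl (hK D fun σ _ i _ j _ => mem_closedBall_zero_iff.2 ?_)
    exact (norm_entry_le_schattenTwoNorm (D σ) i j).trans <| (Finset.single_le_sum
      (f := fun σ => schattenTwoNorm (D σ)) (fun σ _ => schattenTwoNorm_nonneg (D σ))
      (Finset.mem_univ σ)).trans hD
  · have := hR _ hD D rfl
    rw [dist_zero_right, Real.norm_eq_abs, abs_mul, Real.abs_exp, Real.exp_neg,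
      mul_inv_le_iff₀ (Real.exp_pos _)] at this
    exact .inr this

lemma sum_schattenTwoNorm_matricesOfVector_le
    (x : EuclideanSpace ℝ (Σ σ : T, Fin (d σ) × Fin (d σ))) :
    ∑ σ, schattenTwoNorm (matricesOfVector x σ) ≤ ∑ p, |x p| := by
  rw [Fintype.sum_sigma]
  refine Finset.sum_le_sum fun σ _ => (schattenTwoNorm_le_sum _).trans_eq ?_
  simp [matricesOfVector]

end SchattenTwo

/-! ### Quantized systems and the limit theorem. -/

section QuantizedSystems

variable {S T Ω : Type*} [MeasurableSpace Ω] {μ : Measure Ω} {d : S → ℕ}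

lemma IsQuantizedRademacher.precomp
    {ρ : (σ : S) → Ω → Matrix.orthogonalGroup (Fin (d σ)) ℝ} (hρ : IsQuantizedRademacher μ d ρ)
    {e : T → S} (he : Function.Injective e) :
    IsQuantizedRademacher μ (fun σ => d (e σ)) fun σ => ρ (e σ) where
  measurable _ := hρ.measurable _
  indep := hρ.indep.precomp he
  law _ := hρ.law _

lemma IsQuantizedGaussian.precomp
    {γ : (σ : S) → Ω → Matrix (Fin (d σ)) (Fin (d σ)) ℂ} (hγ : IsQuantizedGaussian μ d γ)
    {e : T → S} (he : Function.Injective e) :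
    IsQuantizedGaussian μ (fun σ => d (e σ)) fun σ => γ (e σ) := by
  obtain ⟨g, hg, hind, hlaw, hγ⟩ := hγ
  have hinj : Function.Injective fun p : Σ σ : T, Fin (d (e σ)) × Fin (d (e σ)) =>
      (⟨e p.1, p.2⟩ : Σ σ : S, Fin (d σ) × Fin (d σ)) := by
    rintro ⟨σ, p⟩ ⟨τ, q⟩ hpq
    obtain rfl : σ = τ := he (congrArg Sigma.fst hpq)
    simpa using hpq
  exact ⟨fun p => g ⟨e p.1, p.2⟩, fun p => hg _, hind.precomp hinj, fun p => hlaw _,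
    fun σ => hγ (e σ)⟩

section Entries

variable {ρ : (σ : S) → Ω → Matrix.orthogonalGroup (Fin (d σ)) ℝ}

lemma IsQuantizedRademacher.measurable_entry (hρ : IsQuantizedRademacher μ d ρ) (σ : S)
    (i j : Fin (d σ)) : Measurable fun ω => (ρ σ ω).1 i j :=
  (continuous_orthogonalGroup_entry i j).measurable.comp (hρ.measurable σ)

lemma IsQuantizedRademacher.integral_entry (hρ : IsQuantizedRademacher μ d ρ) (σ : S)
    (i j : Fin (d σ)) : ∫ ω, (ρ σ ω).1 i j ∂μ = 0 := by
  rw [← integral_orthogonalHaar_entry i j, ← hρ.law σ,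
    integral_map (hρ.measurable σ).aemeasurable
      (continuous_orthogonalGroup_entry i j).measurable.aestronglyMeasurable]

lemma IsQuantizedRademacher.integral_entry_mul [DecidableEq S] (hρ : IsQuantizedRademacher μ d ρ)
    (p q : Σ σ : S, Fin (d σ) × Fin (d σ)) :
    ∫ ω, (ρ p.1 ω).1 p.2.1 p.2.2 * (ρ q.1 ω).1 q.2.1 q.2.2 ∂μ =
      if p = q then (1 / √(d p.1)) ^ 2 else 0 := by
  obtain ⟨σ, p⟩ := p
  obtain ⟨τ, q⟩ := q
  by_cases hστ : σ = τ
  · subst hστ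
    have hmeas : Measurable fun A : Matrix.orthogonalGroup (Fin (d σ)) ℝ =>
        A.1 p.1 p.2 * A.1 q.1 q.2 :=
      ((continuous_orthogonalGroup_entry p.1 p.2).mul
        (continuous_orthogonalGroup_entry q.1 q.2)).measurable
    have h := integral_orthogonalHaar_entry_mul p q
    rw [← hρ.law σ, integral_map (hρ.measurable σ).aemeasurable
      hmeas.aestronglyMeasurable] at h
    simpa using h
  · have hind : IndepFun (fun ω => (ρ σ ω).1 p.1 p.2) (fun ω => (ρ τ ω).1 q.1 q.2) μ :=
      (hρ.indep.indepFun hστ).comp (continuous_orthogonalGroup_entry p.1 p.2).measurable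
        (continuous_orthogonalGroup_entry q.1 q.2).measurable
    have h := hind.integral_fun_mul_eq_mul_integral
      (hρ.measurable_entry σ p.1 p.2).aestronglyMeasurable
      (hρ.measurable_entry τ q.1 q.2).aestronglyMeasurable
    rw [hρ.integral_entry, zero_mul] at h
    simpa [hστ] using h

end Entries

/-- Finiteness of `T` makes the vector of all entries finite-dimensional. The gaussian system may
live on any probability space, since only its law matters. -/
theorem integrable_and_tendsto_integral_rademacherSum [IsProbabilityMeasure μ] [Fintype T]
    {d : T → ℕ} (hd : ∀ σ, 0 < d σ)
    {ρ : (σ : T) → Ω → Matrix.orthogonalGroup (Fin (d σ)) ℝ} (hρ : IsQuantizedRademacher μ d ρ)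
    {Ω' : Type*} [MeasurableSpace Ω'] {μ' : Measure Ω'} [IsProbabilityMeasure μ']
    {γ : (σ : T) → Ω' → Matrix (Fin (d σ)) (Fin (d σ)) ℂ} (hγ : IsQuantizedGaussian μ' d γ)
    {h : ((σ : T) → Matrix (Fin (d σ)) (Fin (d σ)) ℂ) → ℝ} (hcont : Continuous h)
    (hgrowth : Tendsto (fun D => h D * Real.exp (-∑ σ, schattenTwoNorm (D σ)))
      (comap (fun D => ∑ σ, schattenTwoNorm (D σ)) atTop) (𝓝 0)) :
    (∀ m : ℕ, Integrable (fun ω : ℕ → Ω => h fun σ => rademacherSum ρ m σ ω)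
      (Measure.infinitePi fun _ : ℕ => μ)) ∧
    Integrable (fun ω => h fun σ => γ σ ω) μ' ∧
    Tendsto
      (fun m : ℕ => ∫ ω : ℕ → Ω, h (fun σ => rademacherSum ρ m σ ω)
        ∂(Measure.infinitePi fun _ : ℕ => μ))
      atTop (𝓝 (∫ ω, h (fun σ => γ σ ω) ∂μ')) := by
  classical
  obtain ⟨g, hg, hind, hlaw, hγ⟩ := hγ
  let ι := Σ σ : T, Fin (d σ) × Fin (d σ)
  let Y : ι → Ω → ℝ := fun p ω => (ρ p.1 ω).1 p.2.1 p.2.2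
  let X : ℕ → (ℕ → Ω) → EuclideanSpace ℝ ι := fun m ω => WithLp.toLp 2
    fun p => (√m)⁻¹ * ∑ k ∈ Finset.range m, Y p (ω k)
  let G : Ω' → EuclideanSpace ℝ ι := fun ω => WithLp.toLp 2 fun p => 1 / √(d p.1) * g p ω
  let f : EuclideanSpace ℝ ι → ℝ := fun x => h (matricesOfVector x)
  let w : EuclideanSpace ℝ ι → ℝ := fun x => Real.exp (∑ p, |x p|)
  have hY : ∀ p, Measurable (Y p) := fun p => hρ.measurable_entry p.1 p.2.1 p.2.2
  have hY1 : ∀ p ω, |Y p ω| ≤ 1 := fun p ω =>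
    orthogonalGroup_abs_entry_le_one (ρ p.1 ω) p.2.1 p.2.2
  have hmean : ∀ p, ∫ ω, Y p ω ∂μ = 0 := fun p => hρ.integral_entry p.1 p.2.1 p.2.2
  have hX : ∀ m, Measurable (X m) := measurable_toLp_inv_sqrt_mul_sum hY
  have hG : Measurable G := by fun_prop
  have hf : Continuous f := hcont.comp continuous_matricesOfVector
  have hw : Continuous w := by fun_prop
  have hsumX : ∀ m ω, (fun σ => rademacherSum ρ m σ ω) = matricesOfVector (X m ω) := by
    intro m ω
    ext σ i j
    simp [rademacherSum, rademacherCopy, matricesOfVector, X, Y, Matrix.sum_apply]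
  have hγG : ∀ ω, (fun σ => γ σ ω) = matricesOfVector (G ω) := by
    intro ω
    ext σ i j
    simp [hγ, matricesOfVector, G]
  have hXw := fun m => integrable_and_integral_exp_sum_abs_le
    fun p => hasSubgaussianMGF_inv_sqrt_mul_sum (hY p) (hY1 p) (hmean p) m
  -- The variances `1 / d p.1` are at most 1 because `d p.1 ≥ 1`.
  have hGw := (integrable_and_integral_exp_sum_abs_le fun p =>
    hasSubgaussianMGF_mul_of_gaussianReal (hg p) (hlaw p) (a := 1 / √(d p.1)) (by
      rw [div_pow, Real.sq_sqrt (Nat.cast_nonneg _), one_pow, one_div]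
      exact inv_le_one_of_one_le₀ (by exact_mod_cast hd p.1))).1
  have hfw : ∀ ε > 0, ∃ K, ∀ x, |f x| ≤ K ∨ |f x| ≤ ε * w x := fun ε hε => by
    obtain ⟨K, hK⟩ := abs_le_or_abs_le_mul_exp_of_tendsto hcont hgrowth hε
    refine ⟨K, fun x => (hK (matricesOfVector x)).imp_right fun hx => hx.trans ?_⟩
    exact mul_le_mul_of_nonneg_left (Real.exp_le_exp.2 <|
      sum_schattenTwoNorm_matricesOfVector_le x) hε.le
  have hclt := tendstoInDistribution_euclidean_inv_sqrt_mul_sum (a := fun p => 1 / √(d p.1)) hY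
    (fun p => MemLp.of_bound (hY p).aestronglyMeasurable 1 (Eventually.of_forall (hY1 p)))
    hmean hρ.integral_entry_mul hg hind hlaw
  have hw0 : ∀ x, 0 ≤ w x := fun x => (Real.exp_pos _).le
  have hwX : ∀ m, Integrable w ((Measure.infinitePi fun _ : ℕ => μ).map (X m)) := fun m =>
    (integrable_map_measure hw.aestronglyMeasurable (hX m).aemeasurable).2 (hXw m).1
  have hwG : Integrable w (μ'.map G) :=
    (integrable_map_measure hw.aestronglyMeasurable hG.aemeasurable).2 hGw
  have := fun m => Measure.isProbabilityMeasure_map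
    (μ := Measure.infinitePi fun _ : ℕ => μ) (hX m).aemeasurable
  have := Measure.isProbabilityMeasure_map (μ := μ') hG.aemeasurable
  have hlim := tendsto_integral_of_tendsto_of_weight hclt.tendsto hf hw0 hwX
    (fun m => (integral_map (hX m).aemeasurable hw.aestronglyMeasurable).trans_le (hXw m).2)
    hwG hfw
  simp only [hsumX, hγG]
  refine ⟨fun m => ?_, ?_, ?_⟩
  · exact (integrable_map_measure hf.aestronglyMeasurable (hX m).aemeasurable).1
      (integrable_of_le_or_le_mul hf hw0 (hwX m) hfw)
  · exact (integrable_map_measure hf.aestronglyMeasurable hG.aemeasurable).1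
      (integrable_of_le_or_le_mul hf hw0 hwG hfw)
  · refine (hlim.congr fun m => ?_).trans_eq ?_
    · exact integral_map (hX m).aemeasurable hf.aestronglyMeasurable
    · exact congrArg 𝓝 (integral_map hG.aemeasurable hf.aestronglyMeasurable)

end QuantizedSystems

end

theorem proposition5p2 {S Ω : Type*} [MeasurableSpace Ω] (μ : Measure Ω) [IsProbabilityMeasure μ]
    (d : S → ℕ) (hd : ∀ σ, 0 < d σ)
    (ρ : (σ : S) → Ω → Matrix.orthogonalGroup (Fin (d σ)) ℝ)
    (hρ : IsQuantizedRademacher μ d ρ)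
    (γ : (σ : S) → (ℕ → Ω) → Matrix (Fin (d σ)) (Fin (d σ)) ℂ)
    (hγ : IsQuantizedGaussian (Measure.infinitePi fun _ : ℕ => μ) d γ)
    (S₀ : Finset S)
    (h : ((σ : S₀) → Matrix (Fin (d σ)) (Fin (d σ)) ℂ) → ℝ)
    (hcont : Continuous h)
    (hgrowth : Tendsto (fun D => h D * Real.exp (-∑ σ, schattenTwoNorm (D σ)))
      (comap (fun D => ∑ σ, schattenTwoNorm (D σ)) atTop) (𝓝 0)) :
    (∀ m : ℕ, 1 ≤ m → Integrable (fun ω : ℕ → Ω => h fun σ => rademacherSum ρ m σ ω)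
      (Measure.infinitePi fun _ : ℕ => μ)) ∧
    Integrable (fun ω : ℕ → Ω => h fun σ => γ σ ω) (Measure.infinitePi fun _ : ℕ => μ) ∧
    Tendsto
      (fun m : ℕ => ∫ ω : ℕ → Ω, h (fun σ => rademacherSum ρ m σ ω)
        ∂(Measure.infinitePi fun _ : ℕ => μ))
      atTop
      (𝓝 (∫ ω : ℕ → Ω, h (fun σ => γ σ ω) ∂(Measure.infinitePi fun _ : ℕ => μ))) := by
  obtain ⟨h1, h2, h3⟩ := integrable_and_tendsto_integral_rademacherSum
    (d := fun σ : S₀ => d σ) (fun σ => hd σ) (hρ.precomp Subtype.val_injective)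
    (hγ.precomp Subtype.val_injective) hcont hgrowth
  exact ⟨fun m _ => h1 m, h2, h3⟩
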